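/- Let $p$ be a prime and let $(B,\mathfrak m)$ be a complete noetherian regular local ring of dimension $d\ge 1$ and characteristic $p$, and let $k\subset B$ be a coefficient field, i.e. a subfield that maps isomorphically onto the residue field $B/\mathfrak m$; identify $k$ with $B/\mathfrak m$. Let $\theta:B\to B$ be a $k$-derivation such that (i) the $k$-linear map $\bar\theta:\mathfrak m/\mathfrak m^2\to k$, $x+\mathfrak m^2\mapsto\theta(x)+\mathfrak m$, is not zero, and (ii) $\theta^p=a\theta$ for some $a\in\mathrm{Frac}(B)$, where $\theta^p$ is the $p$-fold iterate of $\theta$. Then there exists a regular system of parameters $(x_1,\ldots,x_d)$ of $B$ (that is, $d$ generators of $\mathfrak m$) such that $\theta(x_1)\equiv 1\pmod{\mathfrak m}$ and $\theta(x_2)=\cdots=\theta(x_d)=0$. -/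

import Mathlib

open IsLocalRing

noncomputable section

/-- For a derivation `θ : B → B` of a local ring `(B, 𝔪)`, the `B`-linear map `𝔪 → B/𝔪`,
`x ↦ θ x mod 𝔪`. It is `B`-linear since `θ (b x) = b θ x + x θ b ≡ b θ x mod 𝔪` for `x ∈ 𝔪`. -/
def derivMaximalIdeal {k B : Type*} [Field k] [CommRing B] [IsLocalRing B] [Algebra k B]
    (θ : Derivation k B B) : maximalIdeal B →ₗ[B] ResidueField B where
  toFun x := residue B (θ (x : B))
  map_add' x y := by simp
  map_smul' b x := by
    have hx : residue B (x : B) = 0 := (residue_eq_zero_iff _).2 x.2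
    simp [hx, Algebra.smul_def]

/-- The linear map `𝔪/𝔪² → B/𝔪` over the residue field induced by a derivation `θ : B → B` of a
local ring `(B, 𝔪)`; it sends the class of `x ∈ 𝔪` to the class of `θ x`. -/
def derivCotangentSpace {k B : Type*} [Field k] [CommRing B] [IsLocalRing B] [Algebra k B]
    (θ : Derivation k B B) : CotangentSpace B →ₗ[ResidueField B] ResidueField B :=
  LinearMap.extendScalarsOfSurjective (R := B) residue_surjective
    (Ideal.Cotangent.lift (derivMaximalIdeal θ) (by
      intro x y
      have hx : residue B (x : B) = 0 := (residue_eq_zero_iff _).2 x.2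
      have h : derivMaximalIdeal θ ((x : B) • y) = 0 := by
        rw [map_smul, Algebra.smul_def, ResidueField.algebraMap_eq, hx, zero_mul]
      exact h))

theorem derivCotangentSpace_toCotangent {k B : Type*} [Field k] [CommRing B] [IsLocalRing B]
    [Algebra k B] (θ : Derivation k B B) (x : maximalIdeal B) :
    derivCotangentSpace θ ((maximalIdeal B).toCotangent x) = residue B (θ (x : B)) :=
  rfl

/-- A family `(x₁, …, x_d)` of elements of a local ring `(B, 𝔪)` is a regular system of parameters
if `d = dim B` and `x₁, …, x_d` generate `𝔪`. -/
structure IsRegularSystemOfParameters {B : Type*} [CommRing B] [IsLocalRing B] {d : ℕ}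
    (x : Fin d → B) : Prop where
  ringKrullDim_eq : ringKrullDim B = d
  span_range_eq : Ideal.span (Set.range x) = maximalIdeal B

end

/-! Choose a parameter `x₀` with `θ x₀` a unit and rescale `θ` to `D` with `D x₀ = 1`. Expanding `θᵖ
= (u D)ᵖ` in powers of `D` and testing on `1, x₀, …, x₀ᵖ⁻¹` shows that every term below `Dᵖ` except
the one in `D` has coefficient zero, so `Dᵖ = 0`. The truncated Taylor sum `∑_{i<p} (-x₀)ⁱ/i! · Dⁱ
b` is then a constant congruent to `b` modulo `x₀`, and the other parameters are replaced by such
constants. -/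

open Finset Nat in
/-- If `D x = 1`, the Taylor-type polynomial `∑_{i ≤ n} (-x)ⁱ/i! · Dⁱ b` is sent by `D` to
`(-x)ⁿ/n! · Dⁿ⁺¹ b`. -/
theorem Derivation.apply_sum_taylor {k B : Type*} [Field k] [CommRing B] [Algebra k B]
    (D : Derivation k B B) {x : B} (hx : D x = 1) (b : B) (n : ℕ) (hn : ((n ! : ℕ) : k) ≠ 0) :
    D (∑ i ∈ range (n + 1), ((-1) ^ i / ((i ! : ℕ) : k)) • (x ^ i * D^[i] b)) =
      ((-1) ^ n / ((n ! : ℕ) : k)) • (x ^ n * D^[n + 1] b) := by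
  induction n with
  | zero => simp
  | succ n ih =>
    rw [factorial_succ, cast_mul] at hn
    have hn0 : ((n ! : ℕ) : k) ≠ 0 := right_ne_zero_of_mul hn
    have hn1 : ((n + 1 : ℕ) : k) ≠ 0 := left_ne_zero_of_mul hn
    have hc : (-1 : k) ^ n / ((n ! : ℕ) : k) =
        -((-1) ^ (n + 1) / (((n + 1)! : ℕ) : k) * ((n + 1 : ℕ) : k)) := by
      rw [factorial_succ, cast_mul]
      field_simp
      ring
    rw [sum_range_succ, map_add, ih hn0, D.map_smul, D.leibniz, D.leibniz_pow, hx, hc,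
      ← Function.iterate_succ_apply' D (n + 1) b]
    generalize (-1 : k) ^ (n + 1) / (((n + 1)! : ℕ) : k) = t
    simp only [smul_eq_mul, nsmul_eq_mul, Nat.add_sub_cancel]
    simp only [Algebra.smul_def, map_neg, map_mul, _root_.map_natCast]
    ring

/-- If `D x = 1` then `Dⁱ (xʲ) = j (j - 1) ⋯ (j - i + 1) xʲ⁻ⁱ`. -/
theorem Derivation.iterate_apply_pow {k B : Type*} [CommRing k] [CommRing B] [Algebra k B]
    (D : Derivation k B B) {x : B} (hx : D x = 1) (i j : ℕ) :
    D^[i] (x ^ j) = (j.descFactorial i : B) * x ^ (j - i) := by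
  induction i with
  | zero => simp
  | succ i ih =>
    rw [Function.iterate_succ_apply', ih, D.leibniz, D.leibniz_pow, hx, D.map_natCast,
      Nat.descFactorial_succ, Nat.sub_sub]
    simp only [smul_eq_mul, nsmul_eq_mul]
    push_cast
    ring

open Finset in
/-- The iterates of `u • D` are combinations of those of `D`, with leading coefficient `uⁿ`. -/
theorem Derivation.exists_iterate_smul_eq {k B : Type*} [CommRing k] [CommRing B] [Algebra k B]
    (D : Derivation k B B) (u : B) (n : ℕ) :
    ∃ e : ℕ → B, ∀ b, (u • D)^[n] b = ∑ i ∈ range n, e i * D^[i] b + u ^ n * D^[n] b := by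
  induction n with
  | zero => exact ⟨0, by simp⟩
  | succ n ih =>
    obtain ⟨e, he⟩ := ih
    -- Leibniz: `u * D (e i)` differentiates a coefficient, `u * e (i - 1)` raises the order; at `i
    -- = n` the leading `u ^ n` is what gets differentiated.
    refine ⟨fun i => (if i < n then u * D (e i) else u * D (u ^ n)) +
      (if i = 0 then 0 else u * e (i - 1)), fun b => ?_⟩
    have h₁ : ∑ i ∈ range (n + 1),
        (if i < n then u * D (e i) else u * D (u ^ n)) * D^[i] b =
        ∑ i ∈ range n, u * D (e i) * D^[i] b + u * D (u ^ n) * D^[n] b := by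
      rw [sum_range_succ, if_neg (lt_irrefl n)]
      congr 1
      exact sum_congr rfl fun i hi => by rw [if_pos (mem_range.1 hi)]
    have h₂ : ∑ i ∈ range (n + 1), (if i = 0 then 0 else u * e (i - 1)) * D^[i] b =
        ∑ i ∈ range n, u * e i * D^[i + 1] b := by
      rw [sum_range_succ']
      simp
    simp only [add_mul, sum_add_distrib]
    rw [h₁, h₂, Function.iterate_succ_apply' (u • D), he b, Derivation.smul_apply, map_add, map_sum,
      D.leibniz]
    simp only [D.leibniz, smul_eq_mul, ← Function.iterate_succ_apply' D, mul_add, mul_sum,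
      sum_add_distrib]
    have h₃ : ∑ i ∈ range n, u * (e i * D^[i + 1] b) = ∑ i ∈ range n, u * e i * D^[i + 1] b :=
      sum_congr rfl fun i _ => by ring
    have h₄ : ∑ i ∈ range n, u * (D^[i] b * D (e i)) = ∑ i ∈ range n, u * D (e i) * D^[i] b :=
      sum_congr rfl fun i _ => by ring
    rw [h₃, h₄]
    ring

open Finset Nat in
/-- Suppose `D x = 1`, `u` is a unit, and `(u D)ᵖ` is a multiple of `D`. If `(p - 1)!` is invertible
and `p ≥ 2`, then `Dᵖ = 0`. -/
theorem Derivation.iterate_eq_zero_of_iterate_smul {k B : Type*} [CommRing k] [CommRing B]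
    [Algebra k B] (D : Derivation k B B) {x : B} (hx : D x = 1) {u : B} (hu : IsUnit u) {p : ℕ}
    (hp : 2 ≤ p) (hfac : ∀ j < p, IsUnit ((j ! : ℕ) : B)) (c : B)
    (hc : ∀ b, (u • D)^[p] b = c * D b) (b : B) : D^[p] b = 0 := by
  obtain ⟨e, he⟩ := D.exists_iterate_smul_eq u p
  have key : ∀ j < p, e j = if j = 1 then c else 0 := by
    intro j
    induction j using Nat.strong_induction_on with
    | _ j ih =>
      intro hj
      -- On `x ^ j` the terms with `i > j` vanish and those with `i < j` are known by induction,
      -- which isolates `e j * j!`.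
      have h := (hc (x ^ j)).symm.trans (he (x ^ j))
      rw [D.iterate_apply_pow hx p j, descFactorial_of_lt hj, cast_zero, zero_mul, mul_zero,
        add_zero, D.leibniz_pow, hx, ← sum_subset (range_subset_range.2 (succ_le_of_lt hj)), sum_range_succ,
        sum_congr rfl (g := fun i => (if i = 1 then c else 0) * D^[i] (x ^ j))
          (fun i hi => by rw [ih i (mem_range.1 hi) ((mem_range.1 hi).trans hj)])] at h
      · simp only [ite_mul, zero_mul, sum_ite_eq', mem_range, D.iterate_apply_pow hx,
          descFactorial_self, Nat.sub_self, pow_zero, mul_one, smul_eq_mul, nsmul_eq_mul] at h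
        refine (hfac j hj).mul_right_cancel ?_
        rcases lt_trichotomy j 1 with h0 | rfl | h1
        · obtain rfl : j = 0 := by omega
          simpa using h.symm
        · simpa [hx] using h.symm
        · rw [if_pos h1] at h
          rw [if_neg h1.ne', zero_mul]
          simpa [hx, mul_comm c] using h.symm
      · intro i _ hi
        rw [D.iterate_apply_pow hx, descFactorial_of_lt (by simpa using hi)]
        simp
  have h := (hc b).symm.trans (he b)
  rw [sum_congr rfl (g := fun i => (if i = 1 then c else 0) * D^[i] b)
    (fun i hi => by rw [key i (mem_range.1 hi)])] at h
  simp only [ite_mul, zero_mul, sum_ite_eq', mem_range, if_pos (show 1 < p by omega),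
    Function.iterate_one, left_eq_add] at h
  exact (hu.pow p).mul_right_eq_zero.1 h

open Finset Nat in
/-- If `D x = 1` and `Dᵖ = 0` with `(p - 1)!` invertible, every element is congruent modulo `x` to a
constant of `D`. -/
theorem Derivation.exists_apply_eq_zero_of_iterate_eq_zero {k B : Type*} [Field k] [CommRing B]
    [Algebra k B] (D : Derivation k B B) {x : B} (hx : D x = 1) {p : ℕ} (hp : 1 ≤ p)
    (hfac : (((p - 1)! : ℕ) : k) ≠ 0) (hD : ∀ b, D^[p] b = 0) (b : B) :
    ∃ c, D c = 0 ∧ x ∣ b - c := by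
  obtain ⟨n, rfl⟩ : ∃ n, p = n + 1 := ⟨p - 1, by omega⟩
  refine ⟨_, (D.apply_sum_taylor hx b n hfac).trans (by rw [hD]; simp), ?_⟩
  rw [sum_range_succ', ← dvd_neg, neg_sub]
  simp only [pow_zero, factorial_zero, cast_one, div_one, one_smul, one_mul,
    Function.iterate_zero_apply, add_sub_cancel_right]
  refine dvd_sum fun i _ => ?_
  rw [Algebra.smul_def]
  exact (dvd_mul_of_dvd_left (dvd_pow_self x i.succ_ne_zero) _).mul_left _

/-- In a regular local ring of dimension `d`, the maximal ideal is generated by `d` elements. -/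
theorem IsRegularLocalRing.exists_isRegularSystemOfParameters {B : Type*} [CommRing B]
    [IsRegularLocalRing B] {d : ℕ} (hdim : ringKrullDim B = d) :
    ∃ y : Fin d → B, IsRegularSystemOfParameters y := by
  have hfg : (maximalIdeal B).FG := (maximalIdeal B).fg_of_isNoetherianRing
  have hcard : Nat.card (Submodule.generators (maximalIdeal B)) = d := by
    have h := IsRegularLocalRing.spanFinrank_maximalIdeal (R := B)
    rw [hdim, ← Submodule.FG.generators_ncard hfg] at h
    exact_mod_cast h
  have := (Submodule.FG.finite_generators hfg).to_subtype
  refine ⟨Subtype.val ∘ (Finite.equivFinOfCardEq hcard).symm, hdim, ?_⟩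
  rw [Set.range_comp, Equiv.range_eq_univ, Set.image_univ, Subtype.range_coe]
  exact (maximalIdeal B).span_generators

theorem lemma2p1 {k B : Type*} [Field k] [CommRing B] [IsRegularLocalRing B] [Algebra k B]
    -- `B` is complete
    [IsAdicComplete (maximalIdeal B) B]
    -- `B` has prime characteristic `p`
    (p : ℕ) [Fact p.Prime] [CharP B p]
    -- `k` is the residue field of `B`, embedded in `B` as a coefficient field
    (hk : Function.Bijective (algebraMap k (ResidueField B)))
    (d : ℕ) (hd : 1 ≤ d) (hdim : ringKrullDim B = d)
    (θ : Derivation k B B)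
    (hθ : derivCotangentSpace θ ≠ 0)
    (a : FractionRing B)
    (ha : ∀ b : B, algebraMap B (FractionRing B) (θ^[p] b) =
      a * algebraMap B (FractionRing B) (θ b)) :
    ∃ x : Fin d → B, IsRegularSystemOfParameters x ∧
      θ (x ⟨0, hd⟩) - 1 ∈ maximalIdeal B ∧
      ∀ i : Fin d, i ≠ ⟨0, hd⟩ → θ (x i) = 0 := by
  have hp : p.Prime := Fact.out
  have hkp : CharP k p := (algebraMap k B).charP (algebraMap k B).injective p
  have hfac : ∀ j < p, ((j.factorial : ℕ) : k) ≠ 0 := fun j hj h =>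
    hj.not_ge ((hp.dvd_factorial).1 ((CharP.cast_eq_zero_iff k p _).1 h))
  have hfacB : ∀ j < p, IsUnit ((j.factorial : ℕ) : B) := fun j hj => by
    simpa using ((hfac j hj).isUnit).map (algebraMap k B)
  obtain ⟨y, -, hy⟩ := IsRegularLocalRing.exists_isRegularSystemOfParameters hdim
  have hym : ∀ i, y i ∈ maximalIdeal B := fun i => hy ▸ Ideal.subset_span ⟨i, rfl⟩
  obtain ⟨i₀, hi₀⟩ : ∃ i, IsUnit (θ (y i)) := by
    by_contra! h
    refine hθ (LinearMap.ext fun z => ?_)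
    obtain ⟨⟨z, hz⟩, rfl⟩ := (maximalIdeal B).toCotangent_surjective z
    rw [derivCotangentSpace_toCotangent, LinearMap.zero_apply, residue_eq_zero_iff]
    change θ z ∈ maximalIdeal B
    have hz' : z ∈ Ideal.span (Set.range y) := hy.symm ▸ hz
    clear hz
    induction hz' using Submodule.span_induction with
    | mem z hz => obtain ⟨i, rfl⟩ := hz; exact (mem_maximalIdeal _).2 (h i)
    | zero => simp
    | add z w _ _ hz hw => rw [map_add]; exact add_mem hz hw
    | smul b z hz hz' =>
      rw [smul_eq_mul, θ.leibniz]
      exact add_mem (Ideal.mul_mem_left _ _ hz')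
        (Ideal.mul_mem_right _ _ (hy.le hz))
  obtain ⟨v, hv⟩ := hi₀.exists_right_inv
  set x₀ := v * y i₀ with hx₀
  have hx₀m : x₀ ∈ maximalIdeal B := Ideal.mul_mem_left _ _ (hym i₀)
  have hθx₀ : θ x₀ - 1 ∈ maximalIdeal B := by
    have : θ x₀ - 1 = y i₀ * θ v := by
      rw [hx₀, θ.leibniz, smul_eq_mul, smul_eq_mul, mul_comm v, hv]; ring
    exact this ▸ Ideal.mul_mem_right _ _ (hym i₀)
  have hu : IsUnit (θ x₀) := by
    by_contra h
    have := sub_mem ((mem_maximalIdeal _).2 h) hθx₀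
    rw [sub_sub_cancel] at this
    exact (Ideal.ne_top_iff_one _).1 (Ideal.IsPrime.ne_top') this
  obtain ⟨w, hw⟩ := hu.exists_right_inv
  have hD : (θ x₀) • (w • θ) = θ := by rw [smul_smul, hw, one_smul]
  have hDx : (w • θ) x₀ = 1 := by rw [Derivation.smul_apply, smul_eq_mul, mul_comm, hw]
  -- Evaluating `ha` at `x₀`, where `θ x₀` is a unit, shows that `a` comes from `B`.
  have hap : ∀ b, θ^[p] b = w * θ^[p] x₀ * θ b := fun b => by
    apply IsFractionRing.injective B (FractionRing B)
    have hw' : algebraMap B (FractionRing B) (θ x₀) * algebraMap B _ w = 1 := by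
      rw [← map_mul, hw, map_one]
    rw [map_mul, map_mul, ha, ha]
    linear_combination (-a * algebraMap B _ (θ b)) * hw'
  have hDp : ∀ b, (w • θ)^[p] b = 0 := by
    refine (w • θ).iterate_eq_zero_of_iterate_smul hDx hu hp.two_le hfacB
      (w * θ^[p] x₀ * θ x₀) fun b => ?_
    rw [hD, hap, Derivation.smul_apply, smul_eq_mul]
    linear_combination (-(w * θ^[p] x₀ * θ b)) * hw
  choose z hz hxz using (w • θ).exists_apply_eq_zero_of_iterate_eq_zero hDx hp.one_le
    (hfac _ (Nat.sub_lt hp.pos one_pos)) hDp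
  have hθz : ∀ b, θ (z b) = 0 := fun b => by
    rw [← hD, Derivation.smul_apply, hz, smul_zero]
  -- The swap moves the index `i₀` to position `0`, so the other positions run over the remaining `y
  -- i`.
  let x : Fin d → B := fun i =>
    if i = ⟨0, hd⟩ then x₀ else z (y (Equiv.swap ⟨0, hd⟩ i₀ i))
  have hx0 : x ⟨0, hd⟩ = x₀ := if_pos rfl
  have hxi : ∀ i, i ≠ ⟨0, hd⟩ → x i = z (y (Equiv.swap ⟨0, hd⟩ i₀ i)) := fun i hi => if_neg hi
  have hx₀x : x₀ ∈ Ideal.span (Set.range x) := Ideal.subset_span ⟨_, hx0⟩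
  refine ⟨x, ⟨hdim, le_antisymm ?_ ?_⟩, by rwa [hx0], fun i hi => by rw [hxi i hi, hθz]⟩
  · rw [Ideal.span_le]
    rintro _ ⟨i, rfl⟩
    by_cases hi : i = ⟨0, hd⟩
    · rw [hi, hx0]; exact hx₀m
    · rw [hxi i hi, ← sub_sub_cancel (y _) (z _)]
      exact sub_mem (hym _) (Ideal.mem_of_dvd _ (hxz _) hx₀m)
  · rw [← hy, Ideal.span_le]
    rintro _ ⟨j, rfl⟩
    obtain ⟨i, rfl⟩ := (Equiv.swap ⟨0, hd⟩ i₀).surjective j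
    by_cases hi : i = ⟨0, hd⟩
    · have : y i₀ = θ (y i₀) * x₀ := by rw [hx₀, ← mul_assoc, hv, one_mul]
      rw [hi, Equiv.swap_apply_left, this]
      exact Ideal.mul_mem_left _ _ hx₀x
    · rw [← sub_add_cancel (y _) (z (y (Equiv.swap ⟨0, hd⟩ i₀ i)))]
      exact add_mem (Ideal.mem_of_dvd _ (hxz _) hx₀x) (Ideal.subset_span ⟨i, hxi i hi⟩)
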